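/- **Proposition 5 (irreducible representations $\pi_{e,n}$).** Let $h,w\in\mathbb C$ and put $[e]_h=\sinh(he)/h$ for $e\in\mathbb C$. At $h=0$ or $w=0$ the quotients $\sinh(hx)/h$, $(e^{wx}-1)/w$, $(1-e^{-wx})/w$ are read as their limit $x$. The algebra $\mathcal U_{h,w}(\mathcal H(4))$ has generators $N,E,A^+,A$, with $E$ central and $$[A,A^+]=\frac{\sinh(hE)}{h}\,e^{wA^+},\qquad [N,A^+]=\frac{e^{wA^+}-1}{w},\qquad [N,A]=-A .$$ A *representation* of it on a Hausdorff locally convex complex vector space $V$ consists of continuous linear operators $N,E,A^+,A$ on $V$ satisfying these relations, such that all formal power series in $A^+$ converge (unconditionally) at each vector of $V$ and so does the series $\sinh(hE)/h$. It is *irreducible* if $V\neq0$ and the only closed subspaces stable under the generators are $0$ and $V$. It is a *lowest weight* representation if some nonzero vector is killed by $A$ and is an eigenvector of both $N$ and $E$. Two representations are *equivalent* if some linear homeomorphism intertwines the generators. Fix a choice of square roots of complex numbers, with $z^{(k+1)/2}:=(z^{1/2})^{k+1}$. Let $\mathcal V$ be the space of all formal series $\sum_{r\ge0}c_r|r\rangle$,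 $c_r\in\mathbb C$, with the topology of coefficientwise convergence. The vectors $|r\rangle$ form a basis of $\mathcal V$ (in the sense of convergent series) and an orthonormal basis of the Hilbert space of square-summable series. Then: 1. For all $e,n\in\mathbb C$ with $[e]_h\ne0$ there is exactly one representation $\pi_{e,n}$ on $\mathcal V$ such that for all $r\ge 0$ $$A|r\rangle=[e]_h^{1/2}\sqrt r\,|r-1\rangle,\qquad A^+|r\rangle=\sum_{k=0}^\infty\frac{w^k}{k+1}\,[e]_h^{(k+1)/2}\sqrt{\frac{(r+k+1)!}{r!}}\;|r+k+1\rangle,$$ $$\frac{1-e^{-wA^+}}{w}|r\rangle=[e]_h^{1/2}\sqrt{r+1}\,|r+1\rangle,\qquad E|r\rangle=e|r\rangle,\qquad N|r\rangle=(r+n)|r\rangle .$$ It is an infinite-dimensional irreducible lowest weight representation. 2. If $\pi_{e,n}$ and $\pi_{e',n'}$ are equivalent, then $e=e'$ and $n=n'$. 3. Every infinite-dimensional irreducible lowest weight representation of $\mathcal U_{h,w}(\mathcal H(4))$ is equivalent to $\pi_{e,n}$ for some $e,n\in\mathbb C$ with $[e]_h\ne0$. -/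

import Mathlib

/-- Coefficients of the power series `exp (t T) = ∑ t ^ k T ^ k / k!`. -/
noncomputable def expCoeff (t : ℂ) (k : ℕ) : ℂ := t ^ k / (k.factorial : ℂ)

/-- Coefficients of the power series `(exp (t T) - 1) / t = ∑_{k ≥ 1} t ^ (k - 1) T ^ k / k!`;
for `t = 0` this is its limit `T`. -/
noncomputable def expQuotCoeff (t : ℂ) (k : ℕ) : ℂ :=
  if k = 0 then 0 else t ^ (k - 1) / (k.factorial : ℂ)

/-- Coefficients of the power series `sinh (h T) / h = ∑_{k odd} h ^ (k - 1) T ^ k / k!`;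
for `h = 0` this is its limit `T`. -/
noncomputable def sinhQuotCoeff (h : ℂ) (k : ℕ) : ℂ :=
  if Odd k then h ^ (k - 1) / (k.factorial : ℂ) else 0

/-- The number `sinh (h e) / h`, read as its limit `e` for `h = 0`. -/
noncomputable def sinhQuot (h e : ℂ) : ℂ := if h = 0 then e else Complex.sinh (h * e) / h

theorem mul_expQuotCoeff (t : ℂ) (k : ℕ) :
    t * expQuotCoeff t k = expCoeff t k - if k = 0 then 1 else 0 := by
  rcases k with _ | k
  · simp [expQuotCoeff, expCoeff]
  · simp [expQuotCoeff, expCoeff, pow_succ]; ring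

theorem two_mul_mul_sinhQuotCoeff (h : ℂ) (k : ℕ) :
    2 * (h * sinhQuotCoeff h k) = expCoeff h k - expCoeff (-h) k := by
  rcases Nat.even_or_odd k with hk | hk
  · simp [sinhQuotCoeff, expCoeff, Nat.not_odd_iff_even.2 hk, hk.neg_pow]
  · obtain ⟨m, rfl⟩ := hk
    have : Odd (2 * m + 1) := ⟨m, rfl⟩
    simp only [sinhQuotCoeff, expCoeff, this, if_true, this.neg_pow, Nat.add_sub_cancel, pow_succ]
    ring

section

variable {V : Type*} [AddCommGroup V] [Module ℂ V] [TopologicalSpace V]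

/-- The vector `∑ k, c k • T ^ k u`, the value at `u` of the power series with coefficients `c`
in the operator `T`. -/
noncomputable def opSeries (c : ℕ → ℂ) (T : V →L[ℂ] V) (u : V) : V :=
  ∑' k : ℕ, c k • (T ^ k) u

end

/-- A representation of `U_{h,w}(H(4))` on a (Hausdorff, locally convex) complex vector space `V`:
continuous operators `N`, `E`, `Ap` (for `A⁺`), `A` that satisfy the defining relations
`[A, A⁺] = (sinh (h E) / h) e ^ (w A⁺)`, `[N, A⁺] = (e ^ (w A⁺) - 1) / w`, `[N, A] = - A`, with `E`
central. The elements `e ^ (w A⁺)` etc. of the algebra are formal power series in the generator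
`A⁺`, so formal power series in `A⁺` act on `V`; the series `sinh (h E) / h` converges on `V`. -/
structure TwistedHeisenbergRep (h w : ℂ) (V : Type*) [AddCommGroup V] [Module ℂ V]
    [TopologicalSpace V] where
  N : V →L[ℂ] V
  E : V →L[ℂ] V
  Ap : V →L[ℂ] V
  A : V →L[ℂ] V
  summable_Ap : ∀ (c : ℕ → ℂ) (u : V), Summable fun k : ℕ => c k • (Ap ^ k) u
  summable_E : ∀ u : V, Summable fun k : ℕ => sinhQuotCoeff h k • (E ^ k) u
  comm_A_Ap : ∀ u : V,
    A (Ap u) - Ap (A u) = opSeries (sinhQuotCoeff h) E (opSeries (expCoeff w) Ap u)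
  comm_N_Ap : ∀ u : V, N (Ap u) - Ap (N u) = opSeries (expQuotCoeff w) Ap u
  comm_N_A : ∀ u : V, N (A u) - A (N u) = - A u
  comm_E_N : ∀ u : V, E (N u) = N (E u)
  comm_E_Ap : ∀ u : V, E (Ap u) = Ap (E u)
  comm_E_A : ∀ u : V, E (A u) = A (E u)

namespace TwistedHeisenbergRep

variable {h w : ℂ}
variable {V : Type*} [AddCommGroup V] [Module ℂ V] [TopologicalSpace V]
variable {V' : Type*} [AddCommGroup V'] [Module ℂ V'] [TopologicalSpace V']

/-- The action of `(1 - e ^ (- w A⁺)) / w` (its limit `A⁺` for `w = 0`). -/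
noncomputable def X (ρ : TwistedHeisenbergRep h w V) (u : V) : V :=
  opSeries (expQuotCoeff (-w)) ρ.Ap u

/-- A subspace stable under all generators. -/
def IsStable (ρ : TwistedHeisenbergRep h w V) (W : Submodule ℂ V) : Prop :=
  ∀ u ∈ W, ρ.N u ∈ W ∧ ρ.E u ∈ W ∧ ρ.Ap u ∈ W ∧ ρ.A u ∈ W

/-- Irreducibility: the space is nonzero and its only closed stable subspaces are the trivial
ones. -/
def IsIrreducible (ρ : TwistedHeisenbergRep h w V) : Prop :=
  Nontrivial V ∧
    ∀ W : Submodule ℂ V, IsClosed (W : Set V) → ρ.IsStable W → W = ⊥ ∨ W = ⊤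

/-- There is a lowest weight vector (vacuum): a common eigenvector of `N` and of the central
element `E` that is annihilated by `A`. -/
def HasLowestWeightVector (ρ : TwistedHeisenbergRep h w V) : Prop :=
  ∃ v : V, v ≠ 0 ∧ ρ.A v = 0 ∧ (∃ n : ℂ, ρ.N v = n • v) ∧ ∃ e : ℂ, ρ.E v = e • v

/-- Equivalence of representations: a linear homeomorphism that intertwines the generators. -/
def Equivalent (ρ : TwistedHeisenbergRep h w V) (ρ' : TwistedHeisenbergRep h w V') : Prop :=
  ∃ φ : V ≃L[ℂ] V', ∀ u : V, φ (ρ.N u) = ρ'.N (φ u) ∧ φ (ρ.E u) = ρ'.E (φ u) ∧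
    φ (ρ.Ap u) = ρ'.Ap (φ u) ∧ φ (ρ.A u) = ρ'.A (φ u)

/-- The explicit action on vectors `ket r = |r⟩` with parameters `e`, `n`; here `s` is the chosen
square root of `sinh (h e) / h`, and `ket (r - 1)` has coefficient `0` for `r = 0`. -/
def ActsBy (ρ : TwistedHeisenbergRep h w V) (ket : ℕ → V) (s e n : ℂ) : Prop :=
  (∀ r : ℕ, ρ.A (ket r) = (s * (Real.sqrt r : ℂ)) • ket (r - 1)) ∧
  (∀ r : ℕ, HasSum
    (fun k : ℕ => (w ^ k / ((k : ℂ) + 1) * s ^ (k + 1) *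
      (Real.sqrt (((r + k + 1).factorial : ℝ) / (r.factorial : ℝ)) : ℂ)) • ket (r + k + 1))
    (ρ.Ap (ket r))) ∧
  (∀ r : ℕ, ρ.X (ket r) = (s * (Real.sqrt ((r : ℝ) + 1) : ℂ)) • ket (r + 1)) ∧
  (∀ r : ℕ, ρ.E (ket r) = e • ket r) ∧
  (∀ r : ℕ, ρ.N (ket r) = ((r : ℂ) + n) • ket r)

end TwistedHeisenbergRep

/-- The space of formal series `∑ r, c r |r⟩`, as the space of coefficient sequences with the
topology of coefficientwise convergence. -/
abbrev FockSpace : Type := ℕ → ℂ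

/-- The basis vector `|r⟩`. -/
def fockKet (r : ℕ) : FockSpace := Pi.single r 1

/-!
The algebra acts on `ℂ⟦X⟧`, a completed Verma module, with `A⁺` acting as multiplication by `X` and
`A`, `N` as first-order differential operators. A closed subspace stable under `A⁺` is an ideal,
hence is generated by a power of `X` if it is nonzero; since `A` is a unit times `d/dX` when
`sinh (h e) / h ≠ 0`, it lowers this power, and the module is irreducible. The vectors `|r⟩` are
scaled powers of `(1 - e ^ (- w X)) / w`, which is a change of coordinate with inverse
`-log (1 - w X) / w`; this identifies `ℂ⟦X⟧` with the Fock space.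

For a lowest weight vector `v` of an irreducible representation, `f ↦ f(A⁺) v` intertwines the Verma
module with it, by the commutation relations. Its kernel is a closed ideal, and a nonzero one would
make the representation finite dimensional. If the map is injective it is a homeomorphism: all
functionals on the sequence space are finitely supported, so by Hahn–Banach each coordinate is the
restriction of a functional on the target, and these give a continuous inverse.
-/

open Filter Topology
open scoped PowerSeries.WithPiTopology PowerSeries

section SequenceSpace

section PiSingle

variable {ι R V : Type*} [DecidableEq ι] [Semiring R] [TopologicalSpace R] [AddCommMonoid V]
  [Module R V] [TopologicalSpace V]

theorem hasSum_smul_pi_single (c : ι → R) : HasSum (fun i => c i • Pi.single i (1 : R)) c := by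
  refine Pi.hasSum.2 fun j => ?_
  convert hasSum_single j fun i hij => ?_ using 1 <;> simp_all

theorem hasSum_smul_clm_pi_single (f : (ι → R) →L[R] V) (c : ι → R) :
    HasSum (fun i => c i • f (Pi.single i 1)) (f c) := by
  simpa only [map_smul] using (hasSum_smul_pi_single c).mapL f

theorem clm_eq_of_apply_pi_single_eq [T2Space V] {f g : (ι → R) →L[R] V}
    (hfg : ∀ i, f (Pi.single i 1) = g (Pi.single i 1)) : f = g := by
  ext c
  refine (hasSum_smul_clm_pi_single f c).unique ?_
  simpa only [hfg] using hasSum_smul_clm_pi_single g c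

end PiSingle

theorem finite_support_of_forall_summable_mul {ι 𝕜 : Type*} [DivisionRing 𝕜] [TopologicalSpace 𝕜]
    [IsTopologicalAddGroup 𝕜] [T2Space 𝕜] {y : ι → 𝕜} (hy : ∀ c : ι → 𝕜, Summable (c * y)) :
    y.support.Finite := by
  have hne : ∀ᶠ i in cofinite, (y i)⁻¹ * y i ≠ 1 :=
    (hy y⁻¹).tendsto_cofinite_zero.eventually_ne zero_ne_one
  exact Set.Finite.subset hne fun i hi => by simpa using inv_mul_cancel₀ hi

theorem exists_linearCombination_eq_clm {ι 𝕜 : Type*} [Field 𝕜] [TopologicalSpace 𝕜]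
    [IsTopologicalAddGroup 𝕜] [T2Space 𝕜] (l : (ι → 𝕜) →L[𝕜] 𝕜) :
    ∃ m : ι →₀ 𝕜, ∀ c, Finsupp.linearCombination 𝕜 c m = l c := by
  classical
  have hl := hasSum_smul_clm_pi_single l
  have hfin : (fun i => l (Pi.single i 1)).support.Finite :=
    finite_support_of_forall_summable_mul fun c => (hl c).summable
  refine ⟨Finsupp.ofSupportFinite _ hfin, fun c => HasSum.unique ?_ (hl c)⟩
  have hsum := hasSum_sum_of_ne_finset_zero (L := .unconditional ι)
    (f := fun i => c i • l (Pi.single i 1)) (s := hfin.toFinset) (by simp +contextual)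
  convert hsum using 1
  rw [Finsupp.linearCombination_apply, Finsupp.sum]
  exact Finset.sum_congr (by ext; simp [Finsupp.ofSupportFinite]) fun i _ => mul_comm _ _

section SeparatingDual

variable {ι 𝕜 V : Type*} [Field 𝕜] [TopologicalSpace 𝕜] [IsTopologicalRing 𝕜] [T2Space 𝕜]
  [AddCommGroup V] [Module 𝕜 V] [TopologicalSpace V] [SeparatingDual 𝕜 V]

theorem exists_strongDual_comp_eq_proj {f : (ι → 𝕜) →L[𝕜] V}
    (hf : Function.Injective f) (i : ι) : ∃ l : StrongDual 𝕜 V, ∀ c, l (f c) = c i := by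
  let D : Submodule 𝕜 (ι →₀ 𝕜) :=
    (LinearMap.range (f.toLinearMap.dualMap ∘ₗ ContinuousLinearMap.coeLM 𝕜)).comap
      (Finsupp.bilinearCombination 𝕜 𝕜).flip
  have mem_D {m : ι →₀ 𝕜} : m ∈ D ↔
      ∃ l : StrongDual 𝕜 V, ∀ c, l (f c) = Finsupp.linearCombination 𝕜 c m := by
    simp [D, LinearMap.ext_iff]
  -- A sequence annihilated by all functionals `l ∘ f` lies in the kernel of `f`, as `V` has enough
  -- functionals. Hence the `l ∘ f` exhaust the dual of the sequence space.
  have hD : D.dualAnnihilator = ⊥ := by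
    refine (Submodule.eq_bot_iff _).2 fun φ hφ => ?_
    let c : ι → 𝕜 := fun i => φ (Finsupp.single i 1)
    have hφc : φ = Finsupp.linearCombination 𝕜 c := by ext; simp [c]
    have hc : f c = 0 := by
      by_contra hne
      obtain ⟨l, hl⟩ := SeparatingDual.exists_ne_zero (R := 𝕜) hne
      obtain ⟨m, hm⟩ := exists_linearCombination_eq_clm (l ∘L f)
      refine hl ((hm c).symm.trans ?_)
      rw [← hφc]
      exact (Submodule.mem_dualAnnihilator φ).1 hφ m (mem_D.2 ⟨l, fun c => (hm c).symm⟩)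
    rw [hφc, (map_eq_zero_iff f hf).1 hc]
    exact Finsupp.linearCombination_zero ι 𝕜 𝕜
  have hi : Finsupp.single i 1 ∈ D := by
    rw [Submodule.dualAnnihilator_eq_bot_iff.1 hD]
    exact Submodule.mem_top
  simpa using mem_D.1 hi

theorem exists_clm_leftInverse_of_injective {f : (ι → 𝕜) →L[𝕜] V}
    (hf : Function.Injective f) : ∃ g : V →L[𝕜] ι → 𝕜, Function.LeftInverse g f := by
  choose l hl using exists_strongDual_comp_eq_proj hf
  exact ⟨ContinuousLinearMap.pi l, fun c => funext fun i => hl i c⟩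

end SeparatingDual

section LocallyConvex

variable {𝕜 V : Type*} [RCLike 𝕜] [AddCommGroup V] [Module 𝕜 V]
  [TopologicalSpace V] [IsTopologicalAddGroup V] [ContinuousSMul 𝕜 V] [T2Space V]
  [PolynormableSpace 𝕜 V]

theorem separatingDual_of_polynormableSpace : SeparatingDual 𝕜 V := by
  refine ⟨fun x hx => ?_⟩
  obtain ⟨l, hl⟩ := StrongDual.exists_extension (𝕜 := 𝕜) (𝕜 ∙ x)
    (LinearMap.toContinuousLinearMap (LinearEquiv.toSpanNonzeroSingleton 𝕜 V x hx).symm.toLinearMap)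
  refine ⟨l, ?_⟩
  rw [hl ⟨x, Submodule.mem_span_singleton_self x⟩]
  simp [LinearEquiv.coord_self]

/-- The continuous linear map `c ↦ ∑ k, c k • y k`, when all these series converge. Its continuity
is an instance of the Banach–Steinhaus theorem. -/
noncomputable def sumCLM (y : ℕ → V) (hy : ∀ c : ℕ → 𝕜, Summable fun k => c k • y k) :
    (ℕ → 𝕜) →L[𝕜] V :=
  letI := IsTopologicalAddGroup.rightUniformSpace V
  haveI : IsUniformAddGroup V := isUniformAddGroup_of_addCommGroup
  continuousLinearMapOfTendsto
    (fun n : ℕ => ∑ k ∈ Finset.range n,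
      (ContinuousLinearMap.proj (φ := fun _ : ℕ => 𝕜) k).smulRight (y k))
    (f := fun c => ∑' k, c k • y k) (l := atTop)
    (tendsto_pi_nhds.2 fun c => by
      simpa [sum_apply] using (hy c).hasSum.tendsto_sum_nat)

theorem hasSum_sumCLM {y : ℕ → V} (hy : ∀ c : ℕ → 𝕜, Summable fun k => c k • y k) (c : ℕ → 𝕜) :
    HasSum (fun k => c k • y k) (sumCLM y hy c) :=
  (hy c).hasSum

end LocallyConvex

theorem FockSpace.not_finiteDimensional : ¬ FiniteDimensional ℂ FockSpace := fun _ =>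
  have : Finite ℕ := (Pi.linearIndependent_single_one ℕ ℂ).finite
  not_finite ℕ

theorem exists_hilbertBasis_fockKet :
    ∃ b : HilbertBasis ℕ ℂ (lp (fun _ : ℕ => ℂ) 2),
      ∀ r : ℕ, ((b r : lp (fun _ : ℕ => ℂ) 2) : ℕ → ℂ) = fockKet r := by
  refine ⟨HilbertBasis.ofRepr (LinearIsometryEquiv.refl ℂ _), fun r => ?_⟩
  rw [← HilbertBasis.repr_symm_single]
  exact lp.coeFn_single 2 r 1

end SequenceSpace

section FormalSeries

open PowerSeries

section

variable {R : Type*} [TopologicalSpace R]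

/-- The coefficients of a power series, as a linear homeomorphism. -/
noncomputable def coeffEquiv (R : Type*) [Semiring R] [TopologicalSpace R] :
    R⟦X⟧ ≃L[R] (ℕ → R) where
  toFun f k := coeff k f
  map_add' _ _ := rfl
  map_smul' _ _ := rfl
  invFun := mk
  left_inv f := by ext; simp
  right_inv c := by ext; simp
  continuous_toFun := continuous_pi fun k => WithPiTopology.continuous_coeff R k
  continuous_invFun := continuous_pi fun d => continuous_apply (d ())

theorem hasSum_smul_X_pow [CommSemiring R] (f : R⟦X⟧) :
    HasSum (fun k => coeff k f • (X : R⟦X⟧) ^ k) f := by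
  simpa only [monomial_eq_C_mul_X_pow, ← smul_eq_C_mul] using f.hasSum_of_monomials_self

theorem clm_eq_of_forall_apply_X_mul_eq [CommSemiring R] {V : Type*} [AddCommMonoid V] [Module R V]
    [TopologicalSpace V] [T2Space V] {F G : R⟦X⟧ →L[R] V} (h1 : F 1 = G 1)
    (hX : ∀ f, F f = G f → F (X * f) = G (X * f)) : F = G := by
  have hpow (k : ℕ) : F (X ^ k) = G (X ^ k) := by
    induction k with
    | zero => simpa using h1
    | succ k ih => simpa only [pow_succ'] using hX _ ih
  ext f
  refine ((hasSum_smul_X_pow f).mapL F).unique ?_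
  simpa only [map_smul, hpow] using (hasSum_smul_X_pow f).mapL G

theorem hasSum_smul_pow_subst [CommRing R] (f : R⟦X⟧) {g : R⟦X⟧} (hg : HasSubst g) :
    HasSum (fun k => coeff k f • g ^ k) (f.subst g) := by
  refine (WithPiTopology.hasSum_iff_hasSum_coeff R).2 fun d => ?_
  rw [coeff_subst' hg, ← tsum_eq_finsum (L := .unconditional ℕ) (coeff_subst_finite' hg f d)]
  exact (summable_of_hasFiniteSupport (coeff_subst_finite' hg f d)).hasSum

end

section Substitution

variable {R : Type*} [CommRing R] [TopologicalSpace R] [IsTopologicalRing R]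

theorem continuous_subst {P : R⟦X⟧} (hP : constantCoeff P = 0) :
    Continuous fun f : R⟦X⟧ => f.subst P := by
  have hcoeff (d : ℕ) (f : R⟦X⟧) :
      coeff d (f.subst P) = ∑ k ∈ Finset.range (d + 1), coeff k f * coeff d (P ^ k) := by
    rw [coeff_subst' (.of_constantCoeff_zero' hP)]
    refine finsum_eq_sum_of_support_subset _ fun k hk => ?_
    contrapose! hk
    have hdk : d < k := by simpa [Nat.lt_succ_iff] using hk
    simp [X_pow_dvd_iff.1 (pow_dvd_pow_of_dvd (X_dvd_iff.2 hP) k) d hdk]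
  refine (coeffEquiv R).toHomeomorph.isInducing.continuous_iff.2 (continuous_pi fun d => ?_)
  refine (continuous_finsetSum (Finset.range (d + 1)) fun k _ =>
    (WithPiTopology.continuous_coeff R k).mul_const (coeff d (P ^ k))).congr fun f => ?_
  exact (hcoeff d f).symm

/-- Substitution of a power series `P` with `P(0) = 0` and invertible linear coefficient, as a
linear homeomorphism. -/
noncomputable def substEquiv (P : R⟦X⟧) (hP : constantCoeff P = 0) (hP' : IsUnit (coeff 1 P)) :
    R⟦X⟧ ≃L[R] R⟦X⟧ where
  toFun f := f.subst P
  map_add' := subst_add (.of_constantCoeff_zero' hP)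
  map_smul' := subst_smul (.of_constantCoeff_zero' hP)
  invFun f := f.subst (P.substInvOfIsUnit hP')
  left_inv f :=
    (subst_comp_subst_apply (.of_constantCoeff_zero' hP) (.substInvOfIsUnit P hP') f).trans <|
      by rw [P.subst_substInvOfIsUnit_right hP, X_subst]
  right_inv f :=
    (subst_comp_subst_apply (.substInvOfIsUnit P hP') (.of_constantCoeff_zero' hP) f).trans <|
      by rw [P.subst_substInvOfIsUnit_left hP, X_subst]
  continuous_toFun := continuous_subst hP
  continuous_invFun := continuous_subst (constantCoeff_substInvOfIsUnit P hP')

theorem substEquiv_apply {P : R⟦X⟧} (hP : constantCoeff P = 0) (hP' : IsUnit (coeff 1 P))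
    (f : R⟦X⟧) : substEquiv P hP hP' f = f.subst P :=
  rfl

end Substitution

section Exponential

variable (t w : ℂ)

theorem constantCoeff_mk_expQuotCoeff : constantCoeff (mk (expQuotCoeff t)) = 0 := by
  simp [expQuotCoeff]

theorem coeff_one_mk_expQuotCoeff : coeff 1 (mk (expQuotCoeff t)) = 1 := by simp [expQuotCoeff]

theorem C_mul_mk_expQuotCoeff : C t * mk (expQuotCoeff t) = mk (expCoeff t) - 1 := by
  ext k
  simp [mul_expQuotCoeff, coeff_one]

theorem derivative_mk_expQuotCoeff :
    d⁄dX ℂ (mk (expQuotCoeff t)) = mk (expCoeff t) := by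
  ext k
  have := k.factorial_ne_zero
  simp only [coeff_derivative, coeff_mk, expQuotCoeff, expCoeff, Nat.factorial_succ, Nat.cast_mul,
    Nat.cast_succ, Nat.succ_ne_zero, if_false, Nat.add_sub_cancel]
  field_simp

theorem derivative_mk_expCoeff : d⁄dX ℂ (mk (expCoeff t)) = C t * mk (expCoeff t) := by
  rw [← sub_add_cancel (mk (expCoeff t)) 1, ← C_mul_mk_expQuotCoeff, map_add, Derivation.leibniz,
    derivative_mk_expQuotCoeff]
  simp [C_mul_mk_expQuotCoeff]

theorem mk_expCoeff_neg_mul_self : mk (expCoeff (-w)) * mk (expCoeff w) = 1 := by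
  refine derivative.ext ?_ (by simp [expCoeff])
  simp only [Derivation.leibniz, derivative_mk_expCoeff, derivative_one, smul_eq_mul, map_neg]
  ring

theorem mk_expQuotCoeff_mul_mk_expCoeff_neg :
    mk (expQuotCoeff w) * mk (expCoeff (-w)) = mk (expQuotCoeff (-w)) := by
  refine derivative.ext ?_ (by simp [expQuotCoeff])
  simp only [Derivation.leibniz, derivative_mk_expQuotCoeff, derivative_mk_expCoeff, smul_eq_mul,
    map_neg]
  linear_combination -mk (expCoeff (-w)) * C_mul_mk_expQuotCoeff w

theorem derivative_expQuotCoeff_neg_pow (r : ℕ) :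
    d⁄dX ℂ (mk (expQuotCoeff (-w)) ^ r) =
      (r : ℂ) • (mk (expQuotCoeff (-w)) ^ (r - 1) * mk (expCoeff (-w))) := by
  rw [derivative_pow, derivative_mk_expQuotCoeff, mul_assoc, ← map_natCast (C (R := ℂ)),
    ← smul_eq_C_mul]

theorem expCoeff_mul_derivative_pow (r : ℕ) :
    mk (expCoeff w) * d⁄dX ℂ (mk (expQuotCoeff (-w)) ^ r) =
      (r : ℂ) • mk (expQuotCoeff (-w)) ^ (r - 1) := by
  rw [derivative_expQuotCoeff_neg_pow, mul_smul_comm, mul_left_comm, mul_comm (mk (expCoeff w)),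
    mk_expCoeff_neg_mul_self, mul_one]

theorem expQuotCoeff_mul_derivative_pow (r : ℕ) :
    mk (expQuotCoeff w) * d⁄dX ℂ (mk (expQuotCoeff (-w)) ^ r) =
      (r : ℂ) • mk (expQuotCoeff (-w)) ^ r := by
  rw [derivative_expQuotCoeff_neg_pow, mul_smul_comm, mul_left_comm,
    mk_expQuotCoeff_mul_mk_expCoeff_neg]
  rcases r with _ | r
  · simp
  · rw [Nat.add_sub_cancel, pow_succ]

/-- The power series `-log (1 - w X) / w`, read as its limit `X` for `w = 0`. -/
noncomputable def logQuot (w : ℂ) : ℂ⟦X⟧ := X * mk fun k => w ^ k / ((k : ℂ) + 1)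

theorem one_sub_mul_derivative_logQuot : (1 - C w * X) * d⁄dX ℂ (logQuot w) = 1 := by
  have hderiv : d⁄dX ℂ (logQuot w) = mk fun k => w ^ k := by
    ext k
    rw [coeff_derivative, logQuot, coeff_succ_X_mul, coeff_mk, coeff_mk]
    field_simp
  rw [hderiv, mul_comm]
  simpa [rescale_mk, ← Pi.one_def] using congrArg (rescale w) (mk_one_mul_one_sub_eq_one ℂ)

theorem hasSubst_mk_expQuotCoeff : HasSubst (mk (expQuotCoeff t)) :=
  .of_constantCoeff_zero' (constantCoeff_mk_expQuotCoeff t)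

theorem logQuot_subst_expQuotCoeff_neg : (logQuot w).subst (mk (expQuotCoeff (-w))) = X := by
  set x := mk (expQuotCoeff (-w))
  have hx : HasSubst x := hasSubst_mk_expQuotCoeff (-w)
  have hinv : (1 - C w * x) * (d⁄dX ℂ (logQuot w)).subst x = 1 := by
    have := congrArg (substAlgHom hx) (one_sub_mul_derivative_logQuot w)
    simp only [map_mul, map_sub, map_one, coe_substAlgHom, subst_C, subst_X hx] at this
    exact this
  have hexp : mk (expCoeff (-w)) = 1 - C w * x := by
    have := C_mul_mk_expQuotCoeff (-w)
    rw [map_neg] at this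
    linear_combination -this
  refine derivative.ext ?_ ?_
  · rw [derivative_subst hx, derivative_mk_expQuotCoeff, derivative_X, hexp, mul_comm, hinv]
  · rw [constantCoeff_X]
    exact constantCoeff_subst_eq_zero (constantCoeff_mk_expQuotCoeff (-w)) _ (by simp [logQuot])

theorem hasSum_smul_expQuotCoeff_neg_pow :
    HasSum (fun k : ℕ => (w ^ k / ((k : ℂ) + 1)) • mk (expQuotCoeff (-w)) ^ (k + 1))
      (X : ℂ⟦X⟧) := by
  have hsum := hasSum_smul_pow_subst (logQuot w) (hasSubst_mk_expQuotCoeff (-w))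
  rw [logQuot_subst_expQuotCoeff_neg, ← hasSum_nat_add_iff' 1] at hsum
  simpa [logQuot, coeff_succ_X_mul] using hsum

end Exponential

theorem mem_of_hasSum_of_isClosed {ι R M : Type*} [Semiring R] [AddCommMonoid M] [Module R M]
    [TopologicalSpace M] {W : Submodule R M} (hW : IsClosed (W : Set M)) {f : ι → M} {x : M}
    (hf : HasSum f x) (hmem : ∀ i, f i ∈ W) : x ∈ W :=
  hW.mem_of_tendsto hf (.of_forall fun _ => W.sum_mem fun i _ => hmem i)

section ClosedIdeal

variable {K : Type*} [Field K] [TopologicalSpace K] [IsTopologicalSemiring K]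
  {W : Submodule K K⟦X⟧}

theorem mul_mem_of_isClosed (hW : IsClosed (W : Set K⟦X⟧)) (hX : ∀ f ∈ W, X * f ∈ W) (g : K⟦X⟧)
    {f : K⟦X⟧} (hf : f ∈ W) : g * f ∈ W := by
  have hpow (k : ℕ) : X ^ k * f ∈ W := by
    induction k with
    | zero => simpa using hf
    | succ k ih => simpa only [pow_succ', mul_assoc] using hX _ ih
  refine mem_of_hasSum_of_isClosed hW ((hasSum_smul_X_pow g).mul_right f) fun k => ?_
  simpa only [smul_mul_assoc] using W.smul_mem _ (hpow k)

theorem exists_X_pow_mem_of_isClosed (hW : IsClosed (W : Set K⟦X⟧)) (hX : ∀ f ∈ W, X * f ∈ W)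
    (hbot : W ≠ ⊥) : ∃ m : ℕ, X ^ m ∈ W := by
  obtain ⟨f, hf, hf0⟩ := W.ne_bot_iff.1 hbot
  have hunit : Inv_divided_by_X_pow_order hf0 * f = X ^ f.order.toNat := by
    nth_rewrite 2 [← X_pow_order_mul_divXPowOrder (f := f)]
    rw [mul_left_comm, Inv_divided_by_X_pow_order_leftInv hf0, mul_one]
  exact ⟨f.order.toNat, hunit ▸ mul_mem_of_isClosed hW hX _ hf⟩

theorem eq_top_of_isClosed_of_derivative_mem [CharZero K] (hW : IsClosed (W : Set K⟦X⟧))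
    (hX : ∀ f ∈ W, X * f ∈ W) (hd : ∀ f ∈ W, d⁄dX K f ∈ W) (hbot : W ≠ ⊥) : W = ⊤ := by
  obtain ⟨m, hm⟩ := exists_X_pow_mem_of_isClosed hW hX hbot
  have hone : (1 : K⟦X⟧) ∈ W := by
    induction m with
    | zero => simpa using hm
    | succ m ih =>
      have hderiv : ((m : K) + 1) • (X : K⟦X⟧) ^ m ∈ W := by
        have := hd _ hm
        rw [derivative_pow, derivative_X] at this
        convert this using 1
        simp [smul_eq_C_mul]
      exact ih ((W.smul_mem_iff (Nat.cast_add_one_ne_zero m)).1 hderiv)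
  exact (Submodule.eq_top_iff').2 fun g => by simpa using mul_mem_of_isClosed hW hX g hone

end ClosedIdeal

theorem hasSum_sinhQuotCoeff_mul_pow (h e : ℂ) :
    HasSum (fun k => sinhQuotCoeff h k * e ^ k) (sinhQuot h e) := by
  have hinj : Function.Injective fun n : ℕ => 2 * n + 1 := fun a b hab => by simpa using hab
  refine (hinj.hasSum_iff fun k hk => ?_).1 ?_
  · have : ¬ Odd k := fun ⟨m, hm⟩ => hk ⟨m, hm.symm⟩
    simp [sinhQuotCoeff, this]
  · by_cases hh : h = 0
    · subst hh
      convert hasSum_single (f := fun n : ℕ => sinhQuotCoeff 0 (2 * n + 1) * e ^ (2 * n + 1)) 0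
        fun n hn => by simp [sinhQuotCoeff, hn] using 1
      · rfl
      · simp [sinhQuot, sinhQuotCoeff]
    · rw [sinhQuot, if_neg hh]
      refine ((Complex.hasSum_sinh (h * e)).div_const h).congr_fun fun n => ?_
      simp only [Function.comp_apply, sinhQuotCoeff, odd_two_mul_add_one, if_true,
        Nat.add_sub_cancel]
      rw [mul_pow]
      field_simp
      ring

section Operator

variable {V : Type*} [AddCommGroup V] [Module ℂ V] [TopologicalSpace V] {T : V →L[ℂ] V} {e : ℂ}
  {u : V}

theorem clm_pow_apply_of_apply_eq_smul (hu : T u = e • u) (k : ℕ) : (T ^ k) u = e ^ k • u := by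
  induction k with
  | zero => simp
  | succ k ih => rw [pow_succ', mul_apply_eq_comp, ih, map_smul, hu, smul_smul, pow_succ]

section Semiconj

variable {V' : Type*} [AddCommGroup V'] [Module ℂ V'] [TopologicalSpace V'] {T' : V' →L[ℂ] V'}
  {φ : V →L[ℂ] V'}

theorem clm_pow_apply_of_semiconj (hφ : Function.Semiconj φ T T') (k : ℕ) (u : V) :
    φ ((T ^ k) u) = (T' ^ k) (φ u) := by
  induction k with
  | zero => simp
  | succ k ih => rw [pow_succ', pow_succ', mul_apply_eq_comp, mul_apply_eq_comp, ← ih, hφ]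

theorem clm_opSeries [T2Space V'] (hφ : Function.Semiconj φ T T') {c : ℕ → ℂ}
    (hu : Summable fun k => c k • (T ^ k) u) :
    φ (opSeries c T u) = opSeries c T' (φ u) := by
  simp only [opSeries, φ.map_tsum hu, map_smul, clm_pow_apply_of_semiconj hφ]

variable {ψ : V ≃L[ℂ] V'}

theorem semiconj_arrowCongrEquiv (ψ : V ≃L[ℂ] V') (T : V →L[ℂ] V) :
    Function.Semiconj ψ T (ψ.arrowCongrEquiv ψ T) := fun u => by simp

theorem summable_smul_conj_pow {c : ℕ → ℂ} (hu : Summable fun k => c k • (T ^ k) u) :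
    Summable fun k => c k • (ψ.arrowCongrEquiv ψ T ^ k) (ψ u) := by
  refine (hu.mapL ψ.toContinuousLinearMap).congr fun k => ?_
  rw [map_smul, clm_pow_apply_of_semiconj (semiconj_arrowCongrEquiv ψ T)]
  rfl

theorem opSeries_conj [T2Space V'] {c : ℕ → ℂ} (hu : Summable fun k => c k • (T ^ k) u) :
    opSeries c (ψ.arrowCongrEquiv ψ T) (ψ u) = ψ (opSeries c T u) :=
  (clm_opSeries (φ := ψ.toContinuousLinearMap) (semiconj_arrowCongrEquiv ψ T) hu).symm

end Semiconj

variable [ContinuousSMul ℂ V]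

theorem hasSum_sinhQuotCoeff_smul_pow (h : ℂ) (hu : T u = e • u) :
    HasSum (fun k => sinhQuotCoeff h k • (T ^ k) u) (sinhQuot h e • u) := by
  refine ((hasSum_sinhQuotCoeff_mul_pow h e).smul_const u).congr_fun fun k => ?_
  rw [clm_pow_apply_of_apply_eq_smul hu, smul_smul]

theorem opSeries_sinhQuotCoeff [T2Space V] (h : ℂ) (hu : T u = e • u) :
    opSeries (sinhQuotCoeff h) T u = sinhQuot h e • u :=
  (hasSum_sinhQuotCoeff_smul_pow h hu).tsum_eq

end Operator

section Operators

variable {R : Type*} [CommSemiring R] [TopologicalSpace R] [IsTopologicalSemiring R]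

/-- Multiplication by a power series, as a continuous linear operator. -/
noncomputable def mulCLM (g : R⟦X⟧) : R⟦X⟧ →L[R] R⟦X⟧ where
  toLinearMap := LinearMap.mulLeft R g
  cont := continuous_const.mul continuous_id

theorem mulCLM_apply (g f : R⟦X⟧) : mulCLM g f = g * f := rfl

/-- The derivation `d/dX`, as a continuous linear operator. -/
noncomputable def derivativeCLM (R : Type*) [CommSemiring R] [TopologicalSpace R]
    [IsTopologicalSemiring R] : R⟦X⟧ →L[R] R⟦X⟧ where
  toLinearMap := (d⁄dX R).toLinearMap
  cont := by
    refine (coeffEquiv R).toHomeomorph.isInducing.continuous_iff.2 (continuous_pi fun k => ?_)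
    refine ((WithPiTopology.continuous_coeff R (k + 1)).mul_const ((k : R) + 1)).congr fun f => ?_
    exact (coeff_derivative f k).symm

theorem derivativeCLM_apply (f : R⟦X⟧) : derivativeCLM R f = d⁄dX R f := rfl

theorem mulCLM_X_pow_apply (k : ℕ) (f : R⟦X⟧) : (mulCLM X ^ k) f = X ^ k * f := by
  induction k with
  | zero => simp
  | succ k ih => rw [pow_succ', mul_apply_eq_comp, ih, mulCLM_apply, pow_succ', mul_assoc]

theorem hasSum_smul_mulCLM_X_pow (c : ℕ → R) (f : R⟦X⟧) :
    HasSum (fun k => c k • (mulCLM X ^ k) f) (mk c * f) := by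
  simpa only [mulCLM_X_pow_apply, coeff_mk, smul_mul_assoc] using
    (hasSum_smul_X_pow (mk c)).mul_right f

theorem opSeries_mulCLM_X (c : ℕ → ℂ) (f : ℂ⟦X⟧) : opSeries c (mulCLM X) f = mk c * f :=
  (hasSum_smul_mulCLM_X_pow c f).tsum_eq

end Operators

end FormalSeries

namespace TwistedHeisenbergRep

section Intertwining

variable {h w : ℂ} {V V' V'' : Type*}
  [AddCommGroup V] [Module ℂ V] [TopologicalSpace V]
  [AddCommGroup V'] [Module ℂ V'] [TopologicalSpace V']
  [AddCommGroup V''] [Module ℂ V''] [TopologicalSpace V'']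
  {ρ : TwistedHeisenbergRep h w V} {ρ' : TwistedHeisenbergRep h w V'}
  {ρ'' : TwistedHeisenbergRep h w V''}

/-- A lowest weight vector with eigenvalues `n` of `N` and `e` of `E`. -/
structure IsLowestWeightVector (ρ : TwistedHeisenbergRep h w V) (v : V) (n e : ℂ) : Prop where
  ne_zero : v ≠ 0
  A_apply : ρ.A v = 0
  N_apply : ρ.N v = n • v
  E_apply : ρ.E v = e • v

/-- Continuous linear maps that commute with the action of the generators. -/
def Intertwines (ρ : TwistedHeisenbergRep h w V) (ρ' : TwistedHeisenbergRep h w V')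
    (φ : V →L[ℂ] V') : Prop :=
  ∀ u : V, φ (ρ.N u) = ρ'.N (φ u) ∧ φ (ρ.E u) = ρ'.E (φ u) ∧
    φ (ρ.Ap u) = ρ'.Ap (φ u) ∧ φ (ρ.A u) = ρ'.A (φ u)

theorem hasLowestWeightVector_iff :
    ρ.HasLowestWeightVector ↔ ∃ v n e, ρ.IsLowestWeightVector v n e :=
  ⟨fun ⟨v, hv, hA, ⟨n, hN⟩, e, hE⟩ => ⟨v, n, e, hv, hA, hN, hE⟩,
    fun ⟨v, n, e, hv⟩ => ⟨v, hv.ne_zero, hv.A_apply, ⟨n, hv.N_apply⟩, e, hv.E_apply⟩⟩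

theorem IsLowestWeightVector.map {v : V} {n e : ℂ} (hv : ρ.IsLowestWeightVector v n e)
    {φ : V →L[ℂ] V'} (hφ : ρ.Intertwines ρ' φ) (hφv : φ v ≠ 0) :
    ρ'.IsLowestWeightVector (φ v) n e where
  ne_zero := hφv
  A_apply := by rw [← (hφ v).2.2.2, hv.A_apply, map_zero]
  N_apply := by rw [← (hφ v).1, hv.N_apply, map_smul]
  E_apply := by rw [← (hφ v).2.1, hv.E_apply, map_smul]

theorem Intertwines.isStable_comap {φ : V →L[ℂ] V'} (hφ : ρ.Intertwines ρ' φ)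
    {W : Submodule ℂ V'} (hW : ρ'.IsStable W) : ρ.IsStable (W.comap φ.toLinearMap) := by
  intro u hu
  obtain ⟨hN, hE, hAp, hA⟩ := hφ u
  simpa [hN, hE, hAp, hA] using hW (φ u) hu

theorem Intertwines.isStable_range {φ : V →L[ℂ] V'} (hφ : ρ.Intertwines ρ' φ) :
    ρ'.IsStable φ.range := by
  rintro _ ⟨u, rfl⟩
  exact ⟨⟨_, (hφ u).1⟩, ⟨_, (hφ u).2.1⟩, ⟨_, (hφ u).2.2.1⟩, ⟨_, (hφ u).2.2.2⟩⟩

theorem IsStable.topologicalClosure [ContinuousAdd V] [ContinuousConstSMul ℂ V]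
    {W : Submodule ℂ V} (hW : ρ.IsStable W) : ρ.IsStable W.topologicalClosure := fun _ hu =>
  ⟨map_mem_closure ρ.N.continuous hu fun u hu => (hW u hu).1,
    map_mem_closure ρ.E.continuous hu fun u hu => (hW u hu).2.1,
    map_mem_closure ρ.Ap.continuous hu fun u hu => (hW u hu).2.2.1,
    map_mem_closure ρ.A.continuous hu fun u hu => (hW u hu).2.2.2⟩

theorem Intertwines.denseRange [ContinuousAdd V'] [ContinuousConstSMul ℂ V']
    {φ : V →L[ℂ] V'} (hφ : ρ.Intertwines ρ' φ) (hρ' : ρ'.IsIrreducible) (hφ0 : φ ≠ 0) :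
    DenseRange φ := by
  refine (φ.range.dense_iff_topologicalClosure_eq_top.2 ?_)
  refine (hρ'.2 _ φ.range.isClosed_topologicalClosure
    hφ.isStable_range.topologicalClosure).resolve_left fun hbot => hφ0 ?_
  have hrange : φ.range = ⊥ := eq_bot_mono φ.range.le_topologicalClosure hbot
  exact ContinuousLinearMap.coe_injective (LinearMap.range_eq_bot.1 hrange)

theorem Equivalent.symm : ρ.Equivalent ρ' → ρ'.Equivalent ρ := by
  rintro ⟨φ, hφ⟩
  refine ⟨φ.symm, fun u => ?_⟩
  simp [ContinuousLinearEquiv.symm_apply_eq, hφ]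

theorem Equivalent.trans : ρ.Equivalent ρ' → ρ'.Equivalent ρ'' → ρ.Equivalent ρ'' := by
  rintro ⟨φ, hφ⟩ ⟨ψ, hψ⟩
  exact ⟨φ.trans ψ, fun u => by simp [hφ, hψ]⟩

theorem Equivalent.isIrreducible (hρ : ρ.IsIrreducible) :
    ρ.Equivalent ρ' → ρ'.IsIrreducible := by
  rintro ⟨φ, hφ⟩
  have := hρ.1
  refine ⟨φ.injective.nontrivial, fun W hW hstable => ?_⟩
  have hcomap := hρ.2 (W.comap φ.toLinearEquiv.toLinearMap) (hW.preimage φ.continuous)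
    (Intertwines.isStable_comap (φ := φ.toContinuousLinearMap) hφ hstable)
  rw [← Submodule.map_comap_eq_of_surjective φ.toLinearEquiv.surjective W]
  exact hcomap.imp (fun hbot => by rw [hbot, Submodule.map_bot])
    fun htop => by rw [htop, Submodule.map_top, LinearEquiv.range]

theorem Equivalent.exists_isLowestWeightVector {v : V} {n e : ℂ}
    (hv : ρ.IsLowestWeightVector v n e) :
    ρ.Equivalent ρ' → ∃ v', ρ'.IsLowestWeightVector v' n e := by
  rintro ⟨φ, hφ⟩
  exact ⟨φ v, hv.map (φ := φ.toContinuousLinearMap) hφ (φ.map_ne_zero_iff.2 hv.ne_zero)⟩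

theorem map_E_Ap_of_semiconj {φ : V →L[ℂ] V'} (hAp : Function.Semiconj φ ρ.Ap ρ'.Ap) {u : V}
    (hu : φ (ρ.E u) = ρ'.E (φ u)) : φ (ρ.E (ρ.Ap u)) = ρ'.E (φ (ρ.Ap u)) := by
  rw [ρ.comm_E_Ap, hAp, hAp, hu, ρ'.comm_E_Ap]

variable [T2Space V']

theorem map_N_Ap_of_semiconj {φ : V →L[ℂ] V'} (hAp : Function.Semiconj φ ρ.Ap ρ'.Ap) {u : V}
    (hu : φ (ρ.N u) = ρ'.N (φ u)) : φ (ρ.N (ρ.Ap u)) = ρ'.N (φ (ρ.Ap u)) := by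
  rw [sub_eq_iff_eq_add.1 (ρ.comm_N_Ap u), map_add, clm_opSeries hAp (ρ.summable_Ap _ u), hAp, hu,
    hAp, sub_eq_iff_eq_add.1 (ρ'.comm_N_Ap (φ u))]

theorem map_A_Ap_of_semiconj {φ : V →L[ℂ] V'} (hAp : Function.Semiconj φ ρ.Ap ρ'.Ap)
    (hE : Function.Semiconj φ ρ.E ρ'.E) {u : V} (hu : φ (ρ.A u) = ρ'.A (φ u)) :
    φ (ρ.A (ρ.Ap u)) = ρ'.A (φ (ρ.Ap u)) := by
  rw [sub_eq_iff_eq_add.1 (ρ.comm_A_Ap u), map_add, clm_opSeries hE (ρ.summable_E _),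
    clm_opSeries hAp (ρ.summable_Ap _ u), hAp, hu, hAp, sub_eq_iff_eq_add.1 (ρ'.comm_A_Ap (φ u))]

/-- The representation obtained by transporting `ρ` along a linear homeomorphism. -/
noncomputable def congr (ρ : TwistedHeisenbergRep h w V) (φ : V ≃L[ℂ] V') :
    TwistedHeisenbergRep h w V' where
  N := φ.arrowCongrEquiv φ ρ.N
  E := φ.arrowCongrEquiv φ ρ.E
  Ap := φ.arrowCongrEquiv φ ρ.Ap
  A := φ.arrowCongrEquiv φ ρ.A
  summable_Ap c := φ.surjective.forall.2 fun u => summable_smul_conj_pow (ρ.summable_Ap c u)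
  summable_E := φ.surjective.forall.2 fun u => summable_smul_conj_pow (ρ.summable_E u)
  comm_A_Ap := φ.surjective.forall.2 fun u => by
    rw [opSeries_conj (ρ.summable_Ap _ u), opSeries_conj (ρ.summable_E _), ← ρ.comm_A_Ap]
    simp
  comm_N_Ap := φ.surjective.forall.2 fun u => by
    rw [opSeries_conj (ρ.summable_Ap _ u), ← ρ.comm_N_Ap]
    simp
  comm_N_A := φ.surjective.forall.2 fun u => by
    simp [← map_sub, ρ.comm_N_A]
  comm_E_N := φ.surjective.forall.2 fun u => by simp [ρ.comm_E_N]
  comm_E_Ap := φ.surjective.forall.2 fun u => by simp [ρ.comm_E_Ap]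
  comm_E_A := φ.surjective.forall.2 fun u => by simp [ρ.comm_E_A]

theorem intertwines_congr (ρ : TwistedHeisenbergRep h w V) (φ : V ≃L[ℂ] V') :
    ρ.Intertwines (ρ.congr φ) φ := fun u =>
  ⟨semiconj_arrowCongrEquiv φ ρ.N u, semiconj_arrowCongrEquiv φ ρ.E u,
    semiconj_arrowCongrEquiv φ ρ.Ap u, semiconj_arrowCongrEquiv φ ρ.A u⟩

theorem equivalent_congr (ρ : TwistedHeisenbergRep h w V) (φ : V ≃L[ℂ] V') :
    ρ.Equivalent (ρ.congr φ) :=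
  ⟨φ, ρ.intertwines_congr φ⟩

theorem ActsBy.map {ket : ℕ → V} {s e n : ℂ} (hρ : ρ.ActsBy ket s e n) {φ : V →L[ℂ] V'}
    (hφ : ρ.Intertwines ρ' φ) : ρ'.ActsBy (φ ∘ ket) s e n := by
  obtain ⟨hA, hAp, hX, hE, hN⟩ := hρ
  refine ⟨fun r => ?_, fun r => ?_, fun r => ?_, fun r => ?_, fun r => ?_⟩
  · simp only [Function.comp_apply, ← (hφ _).2.2.2, hA, map_smul]
  · simpa only [Function.comp_apply, ← (hφ _).2.2.1, map_smul] using (hAp r).mapL φ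
  · rw [Function.comp_apply, X, ← clm_opSeries (fun u => (hφ u).2.2.1) (ρ.summable_Ap _ _)]
    exact (congrArg φ (hX r)).trans (map_smul φ _ _)
  · simp only [Function.comp_apply, ← (hφ _).2.1, hE, map_smul]
  · simp only [Function.comp_apply, ← (hφ _).1, hN, map_smul]

theorem ActsBy.eq {ρ ρ' : TwistedHeisenbergRep h w FockSpace} {s e n : ℂ}
    (hρ : ρ.ActsBy fockKet s e n) (hρ' : ρ'.ActsBy fockKet s e n) : ρ = ρ' := by
  obtain ⟨hA, hAp, -, hE, hN⟩ := hρ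
  obtain ⟨hA', hAp', -, hE', hN'⟩ := hρ'
  have hN : ρ.N = ρ'.N := clm_eq_of_apply_pi_single_eq fun r => (hN r).trans (hN' r).symm
  have hE : ρ.E = ρ'.E := clm_eq_of_apply_pi_single_eq fun r => (hE r).trans (hE' r).symm
  have hAp : ρ.Ap = ρ'.Ap := clm_eq_of_apply_pi_single_eq fun r => (hAp r).unique (hAp' r)
  have hA : ρ.A = ρ'.A := clm_eq_of_apply_pi_single_eq fun r => (hA r).trans (hA' r).symm
  cases ρ
  cases ρ'
  simp_all

end Intertwining

end TwistedHeisenbergRep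

section Verma

open PowerSeries

/-- The completed Verma module with lowest weight `(n, e)`: `A⁺` acts on `ℂ⟦X⟧` as multiplication
by `X`, and `N` and `A` are the differential operators `n + (e ^ (w X) - 1) / w * d/dX` and
`sinh (h e) / h * e ^ (w X) * d/dX`. -/
noncomputable def vermaRep (h w e n : ℂ) : TwistedHeisenbergRep h w ℂ⟦X⟧ where
  N := n • .id ℂ ℂ⟦X⟧ + mulCLM (mk (expQuotCoeff w)) ∘L derivativeCLM ℂ
  E := e • .id ℂ ℂ⟦X⟧
  Ap := mulCLM X
  A := sinhQuot h e • mulCLM (mk (expCoeff w)) ∘L derivativeCLM ℂ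
  summable_Ap c f := (hasSum_smul_mulCLM_X_pow c f).summable
  summable_E f := (hasSum_sinhQuotCoeff_smul_pow h (e := e) rfl).summable
  comm_A_Ap f := by
    rw [opSeries_sinhQuotCoeff h (e := e) rfl, opSeries_mulCLM_X]
    simp only [mulCLM_apply, smul_apply, ContinuousLinearMap.comp_apply, derivativeCLM_apply,
      Derivation.leibniz, smul_eq_mul, derivative_X, mul_one, smul_eq_C_mul]
    ring
  comm_N_Ap f := by
    rw [opSeries_mulCLM_X]
    simp only [mulCLM_apply, add_apply, smul_apply, ContinuousLinearMap.id_apply, smul_eq_C_mul,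
      ContinuousLinearMap.comp_apply, derivativeCLM_apply, Derivation.leibniz, smul_eq_mul,
      derivative_X, mul_one]
    ring
  comm_N_A f := by
    simp only [mulCLM_apply, add_apply, smul_apply, ContinuousLinearMap.id_apply, smul_eq_C_mul,
      ContinuousLinearMap.comp_apply, derivativeCLM_apply, map_add, Derivation.leibniz, smul_eq_mul,
      derivative_mk_expCoeff, derivative_mk_expQuotCoeff, derivative_C, mul_zero, add_zero]
    linear_combination C (sinhQuot h e) * mk (expCoeff w) * d⁄dX ℂ f * C_mul_mk_expQuotCoeff w
  comm_E_N f := by simp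
  comm_E_Ap f := by simp
  comm_E_A f := by simp [smul_comm e]

variable (h w e n : ℂ)

theorem vermaRep_N_apply (f : ℂ⟦X⟧) :
    (vermaRep h w e n).N f = n • f + mk (expQuotCoeff w) * d⁄dX ℂ f := rfl

theorem vermaRep_E_apply (f : ℂ⟦X⟧) : (vermaRep h w e n).E f = e • f := rfl

theorem vermaRep_Ap_apply (f : ℂ⟦X⟧) : (vermaRep h w e n).Ap f = X * f := rfl

theorem vermaRep_A_apply (f : ℂ⟦X⟧) :
    (vermaRep h w e n).A f = sinhQuot h e • (mk (expCoeff w) * d⁄dX ℂ f) := rfl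

theorem isLowestWeightVector_vermaRep_one : (vermaRep h w e n).IsLowestWeightVector 1 n e where
  ne_zero := one_ne_zero
  A_apply := by simp [vermaRep_A_apply]
  N_apply := by simp [vermaRep_N_apply]
  E_apply := vermaRep_E_apply h w e n 1

variable {h w e n}

theorem derivative_eq_zero_of_vermaRep_A_eq_zero (he : sinhQuot h e ≠ 0) {f : ℂ⟦X⟧}
    (hf : (vermaRep h w e n).A f = 0) : d⁄dX ℂ f = 0 := by
  have hexp : mk (expCoeff w) ≠ 0 := right_ne_zero_of_mul_eq_one (mk_expCoeff_neg_mul_self w)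
  rw [vermaRep_A_apply] at hf
  exact (mul_eq_zero.1 ((smul_eq_zero_iff_right he).1 hf)).resolve_left hexp

theorem eq_of_isLowestWeightVector_vermaRep (he : sinhQuot h e ≠ 0) {f : ℂ⟦X⟧} {n' e' : ℂ}
    (hf : (vermaRep h w e n).IsLowestWeightVector f n' e') : e' = e ∧ n' = n := by
  have hN := hf.N_apply
  rw [vermaRep_N_apply, derivative_eq_zero_of_vermaRep_A_eq_zero he hf.A_apply, mul_zero,
    add_zero] at hN
  exact ⟨smul_left_injective ℂ hf.ne_zero hf.E_apply.symm,
    smul_left_injective ℂ hf.ne_zero hN.symm⟩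

theorem eq_of_equivalent_vermaRep {e' n' : ℂ} (he' : sinhQuot h e' ≠ 0)
    (hequiv : (vermaRep h w e n).Equivalent (vermaRep h w e' n')) : e = e' ∧ n = n' := by
  obtain ⟨f, hf⟩ :=
    hequiv.exists_isLowestWeightVector (isLowestWeightVector_vermaRep_one h w e n)
  exact eq_of_isLowestWeightVector_vermaRep he' hf

theorem isIrreducible_vermaRep (he : sinhQuot h e ≠ 0) (w n : ℂ) :
    (vermaRep h w e n).IsIrreducible := by
  refine ⟨inferInstance, fun W hW hstable => or_iff_not_imp_left.2 ?_⟩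
  have hX : ∀ f ∈ W, X * f ∈ W := fun f hf => (hstable f hf).2.2.1
  refine eq_top_of_isClosed_of_derivative_mem hW hX fun f hf => ?_
  have hA : mk (expCoeff w) * d⁄dX ℂ f ∈ W := (W.smul_mem_iff he).1 (hstable f hf).2.2.2
  have := mul_mem_of_isClosed hW hX (mk (expCoeff (-w))) hA
  rwa [← mul_assoc, mk_expCoeff_neg_mul_self, one_mul] at this

theorem sinhQuot_ne_zero_of_isIrreducible_vermaRep (hρ : (vermaRep h w e n).IsIrreducible) :
    sinhQuot h e ≠ 0 := fun he => by
  let I : Submodule ℂ ℂ⟦X⟧ := LinearMap.ker (coeff 0)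
  have hI : IsClosed (I : Set ℂ⟦X⟧) :=
    isClosed_singleton.preimage (WithPiTopology.continuous_coeff ℂ 0)
  have hstable : (vermaRep h w e n).IsStable I := fun f (hf : coeff 0 f = 0) => by
    simp_all [I, vermaRep_N_apply, vermaRep_E_apply, vermaRep_Ap_apply, vermaRep_A_apply,
      expQuotCoeff]
  rcases hρ.2 I hI hstable with hbot | htop
  · have hX : (X : ℂ⟦X⟧) ∈ I := by simp [I]
    exact X_ne_zero ((Submodule.eq_bot_iff I).1 hbot X hX)
  · have hone : (1 : ℂ⟦X⟧) ∈ I := htop ▸ Submodule.mem_top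
    simp [I] at hone

end Verma

namespace TwistedHeisenbergRep

section OrbitMap

variable {h w : ℂ} {V : Type*} [AddCommGroup V] [Module ℂ V] [TopologicalSpace V] [T2Space V]
  {ρ : TwistedHeisenbergRep h w V} {v : V} {e n : ℂ}

theorem intertwines_vermaRep {φ : ℂ⟦X⟧ →L[ℂ] V}
    (hAp : Function.Semiconj φ (vermaRep h w e n).Ap ρ.Ap)
    (hv : ρ.IsLowestWeightVector (φ 1) n e) : (vermaRep h w e n).Intertwines ρ φ := by
  have hone := isLowestWeightVector_vermaRep_one h w e n
  have hE : φ ∘L (vermaRep h w e n).E = ρ.E ∘L φ :=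
    clm_eq_of_forall_apply_X_mul_eq (by simp [hone.E_apply, hv.E_apply])
      fun _ => map_E_Ap_of_semiconj hAp
  have hN : φ ∘L (vermaRep h w e n).N = ρ.N ∘L φ :=
    clm_eq_of_forall_apply_X_mul_eq (by simp [hone.N_apply, hv.N_apply])
      fun _ => map_N_Ap_of_semiconj hAp
  have hA : φ ∘L (vermaRep h w e n).A = ρ.A ∘L φ :=
    clm_eq_of_forall_apply_X_mul_eq (by simp [hone.A_apply, hv.A_apply])
      fun _ => map_A_Ap_of_semiconj hAp (DFunLike.congr_fun hE)
  exact fun u => ⟨DFunLike.congr_fun hN u, DFunLike.congr_fun hE u, hAp u,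
    DFunLike.congr_fun hA u⟩

section

variable [IsTopologicalAddGroup V] [ContinuousSMul ℂ V] [PolynormableSpace ℂ V]

/-- The map `f ↦ f(A⁺) v` from formal power series to the representation space. -/
noncomputable def orbitMap (ρ : TwistedHeisenbergRep h w V) (v : V) : ℂ⟦X⟧ →L[ℂ] V :=
  sumCLM (fun k => (ρ.Ap ^ k) v) (fun c => ρ.summable_Ap c v) ∘L (coeffEquiv ℂ : ℂ⟦X⟧ →L[ℂ] ℕ → ℂ)

theorem hasSum_orbitMap (ρ : TwistedHeisenbergRep h w V) (v : V) (f : ℂ⟦X⟧) :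
    HasSum (fun k => PowerSeries.coeff k f • (ρ.Ap ^ k) v) (ρ.orbitMap v f) :=
  hasSum_sumCLM (fun c => ρ.summable_Ap c v) _

theorem orbitMap_X_pow (ρ : TwistedHeisenbergRep h w V) (v : V) (k : ℕ) :
    ρ.orbitMap v (PowerSeries.X ^ k) = (ρ.Ap ^ k) v := by
  refine (hasSum_orbitMap ρ v _).unique ?_
  convert hasSum_single k fun j hjk => ?_ using 1 <;>
    simp_all [PowerSeries.coeff_X_pow]

theorem orbitMap_one (ρ : TwistedHeisenbergRep h w V) (v : V) : ρ.orbitMap v 1 = v := by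
  simpa using ρ.orbitMap_X_pow v 0

theorem orbitMap_X_mul (ρ : TwistedHeisenbergRep h w V) (v : V) (f : ℂ⟦X⟧) :
    ρ.orbitMap v (PowerSeries.X * f) = ρ.Ap (ρ.orbitMap v f) := by
  refine ((hasSum_smul_X_pow f).mapL (ρ.orbitMap v ∘L mulCLM PowerSeries.X)).unique ?_
  convert (hasSum_orbitMap ρ v f).mapL ρ.Ap using 2 with k
  rw [map_smul, map_smul, ContinuousLinearMap.comp_apply, mulCLM_apply, ← pow_succ', orbitMap_X_pow,
    pow_succ', mul_apply_eq_comp]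

theorem IsLowestWeightVector.intertwines_orbitMap (hv : ρ.IsLowestWeightVector v n e) :
    (vermaRep h w e n).Intertwines ρ (ρ.orbitMap v) :=
  intertwines_vermaRep (ρ.orbitMap_X_mul v) (by rwa [orbitMap_one])

theorem IsLowestWeightVector.denseRange_orbitMap (hv : ρ.IsLowestWeightVector v n e)
    (hρ : ρ.IsIrreducible) : DenseRange (ρ.orbitMap v) :=
  hv.intertwines_orbitMap.denseRange hρ fun h0 => hv.ne_zero <| by
    rw [← ρ.orbitMap_one v, h0, zero_apply]

theorem finiteDimensional_of_pow_apply_eq_zero (hdense : DenseRange (ρ.orbitMap v)) {m : ℕ}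
    (hm : (ρ.Ap ^ m) v = 0) : FiniteDimensional ℂ V := by
  let S : Submodule ℂ V := Submodule.span ℂ ((fun k => (ρ.Ap ^ k) v) '' Set.Iio m)
  have : FiniteDimensional ℂ S := .span_of_finite ℂ ((Set.finite_Iio m).image _)
  have hpow (k : ℕ) : (ρ.Ap ^ k) v ∈ S := by
    rcases lt_or_ge k m with hk | hk
    · exact Submodule.subset_span ⟨k, hk, rfl⟩
    · obtain ⟨j, rfl⟩ := Nat.exists_eq_add_of_le' hk
      simp [pow_add, hm]
  have hS : IsClosed (S : Set V) := S.closed_of_finiteDimensional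
  have hrange : Set.range (ρ.orbitMap v) ⊆ S := by
    rintro _ ⟨f, rfl⟩
    exact mem_of_hasSum_of_isClosed hS (ρ.hasSum_orbitMap v f) fun k => S.smul_mem _ (hpow k)
  have htop : S = ⊤ := (Submodule.eq_top_iff').2 fun u => hS.closure_subset_iff.2 hrange (hdense u)
  exact Module.finite_def.2 (htop ▸ (Submodule.fg_top S).1 Module.Finite.fg_top)

theorem orbitMap_injective (hfin : ¬ FiniteDimensional ℂ V)
    (hdense : DenseRange (ρ.orbitMap v)) : Function.Injective (ρ.orbitMap v) := by
  refine LinearMap.ker_eq_bot.1 (by_contra fun hbot => hfin ?_)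
  have hX (f : ℂ⟦X⟧) (hf : f ∈ (ρ.orbitMap v).ker) : PowerSeries.X * f ∈ (ρ.orbitMap v).ker := by
    simp_all [orbitMap_X_mul]
  obtain ⟨m, hm⟩ := exists_X_pow_mem_of_isClosed (ρ.orbitMap v).isClosed_ker hX hbot
  exact finiteDimensional_of_pow_apply_eq_zero hdense ((ρ.orbitMap_X_pow v m).symm.trans hm)

theorem exists_orbitEquiv (hfin : ¬ FiniteDimensional ℂ V) (hdense : DenseRange (ρ.orbitMap v)) :
    ∃ φ : ℂ⟦X⟧ ≃L[ℂ] V, φ.toContinuousLinearMap = ρ.orbitMap v := by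
  have : SeparatingDual ℂ V := separatingDual_of_polynormableSpace
  obtain ⟨g, hg⟩ := exists_clm_leftInverse_of_injective
    (f := ρ.orbitMap v ∘L ((coeffEquiv ℂ).symm : (ℕ → ℂ) →L[ℂ] ℂ⟦X⟧))
    ((orbitMap_injective hfin hdense).comp (coeffEquiv ℂ).symm.injective)
  let ψ : V →L[ℂ] ℂ⟦X⟧ := ((coeffEquiv ℂ).symm : (ℕ → ℂ) →L[ℂ] ℂ⟦X⟧) ∘L g
  have hleft : Function.LeftInverse ψ (ρ.orbitMap v) := (coeffEquiv ℂ).symm.surjective.forall.2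
    fun c => congrArg (coeffEquiv ℂ).symm (hg c)
  have hright : ρ.orbitMap v ∘ ψ = id :=
    hdense.equalizer ((ρ.orbitMap v).continuous.comp ψ.continuous) continuous_id
      (funext fun f => congrArg (ρ.orbitMap v) (hleft f))
  exact ⟨.equivOfInverse (ρ.orbitMap v) ψ hleft (congrFun hright), rfl⟩

theorem IsLowestWeightVector.equivalent_vermaRep (hv : ρ.IsLowestWeightVector v n e)
    (hρ : ρ.IsIrreducible) (hfin : ¬ FiniteDimensional ℂ V) : (vermaRep h w e n).Equivalent ρ := by
  obtain ⟨φ, hφ⟩ := exists_orbitEquiv hfin (hv.denseRange_orbitMap hρ)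
  exact ⟨φ, fun u => (hφ ▸ hv.intertwines_orbitMap :) u⟩

end

end OrbitMap

end TwistedHeisenbergRep

section Ket

open PowerSeries

/-- The norm of `(A⁺) ^ r |0⟩` for the undeformed oscillator, up to the phase of `s`. -/
noncomputable def ketWeight (s : ℂ) (r : ℕ) : ℂ := s ^ r * (Real.sqrt (r.factorial : ℝ) : ℂ)

theorem ketWeight_ne_zero {s : ℂ} (hs : s ≠ 0) (r : ℕ) : ketWeight s r ≠ 0 := by
  have : Real.sqrt (r.factorial : ℝ) ≠ 0 := by positivity
  exact mul_ne_zero (pow_ne_zero r hs) (Complex.ofReal_ne_zero.2 this)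

theorem ketWeight_add (s : ℂ) (r k : ℕ) :
    ketWeight s (r + k) =
      s ^ k * (Real.sqrt (((r + k).factorial : ℝ) / (r.factorial : ℝ)) : ℂ) * ketWeight s r := by
  have hsqrt : Real.sqrt ((r + k).factorial / r.factorial) * Real.sqrt r.factorial =
      Real.sqrt (r + k).factorial := by
    rw [← Real.sqrt_mul (by positivity), div_mul_cancel₀ _ (by positivity)]
  rw [ketWeight, ketWeight, ← hsqrt, Complex.ofReal_mul]
  ring

theorem ketWeight_succ (s : ℂ) (r : ℕ) :
    ketWeight s (r + 1) = s * (Real.sqrt ((r : ℝ) + 1) : ℂ) * ketWeight s r := by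
  have hquot : ((r + 1).factorial : ℝ) / r.factorial = r + 1 := by
    rw [Nat.factorial_succ, Nat.cast_mul, mul_div_cancel_right₀ _ (by positivity), Nat.cast_succ]
  rw [ketWeight_add, hquot, pow_one]

/-- The vector `|r⟩` in the completed Verma module: on the unit vectors `|r⟩` the element
`(1 - e ^ (- w A⁺)) / w` is an undeformed creation operator. -/
noncomputable def ketSeries (w s : ℂ) (r : ℕ) : ℂ⟦X⟧ :=
  (ketWeight s r)⁻¹ • mk (expQuotCoeff (-w)) ^ r

variable {s : ℂ} (hs : s ≠ 0) (w : ℂ)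

include hs

theorem pow_mul_ketSeries (r k : ℕ) :
    mk (expQuotCoeff (-w)) ^ k * ketSeries w s r =
      (s ^ k * (Real.sqrt (((r + k).factorial : ℝ) / (r.factorial : ℝ)) : ℂ)) •
        ketSeries w s (r + k) := by
  have hr := ketWeight_ne_zero hs r
  have hrk := ketWeight_ne_zero hs (r + k)
  rw [ketSeries, ketSeries, mul_smul_comm, smul_smul, ← pow_add, add_comm k r]
  congr 1
  rw [eq_mul_inv_iff_mul_eq₀ hrk, inv_mul_eq_iff_eq_mul₀ hr, ketWeight_add]
  ring

theorem mul_ketSeries (r : ℕ) :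
    mk (expQuotCoeff (-w)) * ketSeries w s r =
      (s * (Real.sqrt ((r : ℝ) + 1) : ℂ)) • ketSeries w s (r + 1) := by
  have hr := ketWeight_ne_zero hs r
  have hr1 := ketWeight_ne_zero hs (r + 1)
  rw [ketSeries, ketSeries, mul_smul_comm, smul_smul, ← pow_succ']
  congr 1
  rw [eq_mul_inv_iff_mul_eq₀ hr1, inv_mul_eq_iff_eq_mul₀ hr, ketWeight_succ, mul_comm]

theorem hasSum_X_mul_ketSeries (r : ℕ) :
    HasSum (fun k : ℕ => (w ^ k / ((k : ℂ) + 1) * s ^ (k + 1) *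
      (Real.sqrt (((r + k + 1).factorial : ℝ) / (r.factorial : ℝ)) : ℂ)) •
        ketSeries w s (r + k + 1)) (X * ketSeries w s r) := by
  refine ((hasSum_smul_expQuotCoeff_neg_pow w).mul_right (ketSeries w s r)).congr_fun fun k => ?_
  rw [smul_mul_assoc, pow_mul_ketSeries hs, smul_smul, mul_assoc, add_assoc]

theorem smul_expCoeff_mul_derivative_ketSeries (r : ℕ) :
    s ^ 2 • (mk (expCoeff w) * d⁄dX ℂ (ketSeries w s r)) =
      (s * (Real.sqrt r : ℂ)) • ketSeries w s (r - 1) := by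
  rw [ketSeries, Derivation.map_smul, mul_smul_comm, expCoeff_mul_derivative_pow]
  rcases r with _ | r
  · simp
  have hr := ketWeight_ne_zero hs r
  have hr1 := ketWeight_ne_zero hs (r + 1)
  have hsqrt : (Real.sqrt ((r : ℝ) + 1) : ℂ) ^ 2 = r + 1 := by
    rw [← Complex.ofReal_pow, Real.sq_sqrt (by positivity)]
    push_cast
    rfl
  rw [ketSeries, smul_smul, smul_smul, smul_smul, Nat.add_sub_cancel]
  congr 1
  push_cast
  field_simp
  rw [ketWeight_succ, ← hsqrt]
  ring

end Ket

namespace TwistedHeisenbergRep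

variable {h w e s : ℂ}

theorem actsBy_vermaRep (w n : ℂ) (hs : s ≠ 0) (hse : s ^ 2 = sinhQuot h e) :
    (vermaRep h w e n).ActsBy (ketSeries w s) s e n := by
  refine ⟨fun r => ?_, fun r => hasSum_X_mul_ketSeries hs w r, fun r => ?_,
    fun r => vermaRep_E_apply h w e n _, fun r => ?_⟩
  · rw [vermaRep_A_apply, ← hse, smul_expCoeff_mul_derivative_ketSeries hs]
  · exact (opSeries_mulCLM_X _ _).trans (mul_ketSeries hs w r)
  · rw [vermaRep_N_apply, ketSeries, Derivation.map_smul, mul_smul_comm,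
      expQuotCoeff_mul_derivative_pow, smul_comm _ (r : ℂ), ← add_smul, add_comm]

/-- The linear homeomorphism that maps the vectors `ketSeries w s r` to the unit vectors. -/
noncomputable def ketEquiv (w : ℂ) (hs : s ≠ 0) : ℂ⟦X⟧ ≃L[ℂ] FockSpace :=
  (substEquiv (PowerSeries.mk (expQuotCoeff (-w))) (constantCoeff_mk_expQuotCoeff (-w))
    (coeff_one_mk_expQuotCoeff (-w) ▸ isUnit_one)).symm.trans <|
  (coeffEquiv ℂ).trans <| .piCongrRight fun r =>
    ContinuousLinearEquiv.unitsEquivAut ℂ (Units.mk0 (ketWeight s r) (ketWeight_ne_zero hs r))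

theorem ketEquiv_ketSeries (hs : s ≠ 0) (r : ℕ) : ketEquiv w hs (ketSeries w s r) = fockKet r := by
  have hsubst : (substEquiv _ (constantCoeff_mk_expQuotCoeff (-w))
      (coeff_one_mk_expQuotCoeff (-w) ▸ isUnit_one)).symm (ketSeries w s r) =
      (ketWeight s r)⁻¹ • PowerSeries.X ^ r := by
    have hx := hasSubst_mk_expQuotCoeff (-w)
    rw [ContinuousLinearEquiv.symm_apply_eq, map_smul, substEquiv_apply, PowerSeries.subst_pow hx,
      PowerSeries.subst_X hx, ketSeries]
  funext k
  calc ketEquiv w hs (ketSeries w s r) k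
    _ = PowerSeries.coeff k ((ketWeight s r)⁻¹ • (PowerSeries.X : ℂ⟦X⟧) ^ r) * ketWeight s k := by
      rw [← hsubst]
      rfl
    _ = fockKet r k := by
      rcases eq_or_ne k r with rfl | hkr
      · simp [fockKet, PowerSeries.coeff_X_pow, ketWeight_ne_zero hs]
      · simp [fockKet, PowerSeries.coeff_X_pow, hkr]

/-- The representation `π_{e,n}` on the Fock space; `s` is the square root of `sinh (h e) / h` that
occurs in its formulas. -/
noncomputable def fockRep (h w e n : ℂ) (hs : s ≠ 0) : TwistedHeisenbergRep h w FockSpace :=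
  (vermaRep h w e n).congr (ketEquiv w hs)

theorem equivalent_fockRep (h w e n : ℂ) (hs : s ≠ 0) :
    (vermaRep h w e n).Equivalent (fockRep h w e n hs) :=
  equivalent_congr _ _

theorem actsBy_fockRep (w n : ℂ) (hs : s ≠ 0) (hse : s ^ 2 = sinhQuot h e) :
    (fockRep h w e n hs).ActsBy fockKet s e n := by
  have hket : ketEquiv w hs ∘ ketSeries w s = fockKet := funext (ketEquiv_ketSeries hs)
  exact hket ▸ (actsBy_vermaRep w n hs hse).map (intertwines_congr _ _)

end TwistedHeisenbergRep

open TwistedHeisenbergRep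

theorem proposition5 (h w : ℂ) (root : ℂ → ℂ) (hroot : ∀ z : ℂ, root z ^ 2 = z) :
    -- the vectors `|r⟩` are a basis of the space of formal series ...
    (∀ c : ℕ → ℂ, HasSum (fun r : ℕ => c r • fockKet r) (c : FockSpace)) ∧
    -- ... and an orthonormal basis of its subspace of square-summable series
    (∃ b : HilbertBasis ℕ ℂ (lp (fun _ : ℕ => ℂ) 2),
      ∀ r : ℕ, ((b r : lp (fun _ : ℕ => ℂ) 2) : ℕ → ℂ) = fockKet r) ∧
    ∃ π : (e n : ℂ) → sinhQuot h e ≠ 0 → TwistedHeisenbergRep h w FockSpace,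
      -- `π e n` is the one and only representation given by the explicit formulas
      (∀ (e n : ℂ) (he : sinhQuot h e ≠ 0) (ρ : TwistedHeisenbergRep h w FockSpace),
        ρ.ActsBy fockKet (root (sinhQuot h e)) e n ↔ ρ = π e n he) ∧
      -- it is irreducible, infinite dimensional and has a lowest weight vector
      (∀ (e n : ℂ) (he : sinhQuot h e ≠ 0),
        (π e n he).IsIrreducible ∧ ¬ FiniteDimensional ℂ FockSpace ∧
          (π e n he).HasLowestWeightVector) ∧
      -- different labels give inequivalent representations
      (∀ (e n e' n' : ℂ) (he : sinhQuot h e ≠ 0) (he' : sinhQuot h e' ≠ 0),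
        (π e n he).Equivalent (π e' n' he') → e = e' ∧ n = n') ∧
      -- every infinite-dimensional irreducible lowest weight representation is some `π e n`
      (∀ (V : Type*) [AddCommGroup V] [Module ℂ V] [TopologicalSpace V]
        [IsTopologicalAddGroup V] [ContinuousSMul ℂ V] [T2Space V] [PolynormableSpace ℂ V]
        (ρ : TwistedHeisenbergRep h w V),
        ρ.IsIrreducible → ¬ FiniteDimensional ℂ V → ρ.HasLowestWeightVector →
          ∃ (e n : ℂ) (he : sinhQuot h e ≠ 0), ρ.Equivalent (π e n he)) := by
  have hs (e : ℂ) (he : sinhQuot h e ≠ 0) : root (sinhQuot h e) ≠ 0 := fun h0 => he <| by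
    rw [← hroot (sinhQuot h e), h0, zero_pow two_ne_zero]
  have hverma (e n : ℂ) (he : sinhQuot h e ≠ 0) := equivalent_fockRep h w e n (hs e he)
  have hacts (e n : ℂ) (he : sinhQuot h e ≠ 0) := actsBy_fockRep w n (hs e he) (hroot _)
  refine ⟨hasSum_smul_pi_single, exists_hilbertBasis_fockKet,
    fun e n he => fockRep h w e n (hs e he), fun e n he ρ => ?unique, fun e n he => ?irreducible,
    fun e n e' n' he he' => ?inequivalent, fun V _ _ _ _ _ _ _ ρ hρ hfin hlow => ?classification⟩
  case unique => exact ⟨fun hρ => hρ.eq (hacts e n he), fun hρ => hρ ▸ hacts e n he⟩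
  case irreducible =>
    obtain ⟨v, hv⟩ := (hverma e n he).exists_isLowestWeightVector
      (isLowestWeightVector_vermaRep_one h w e n)
    exact ⟨(hverma e n he).isIrreducible (isIrreducible_vermaRep he w n),
      FockSpace.not_finiteDimensional, hasLowestWeightVector_iff.2 ⟨v, n, e, hv⟩⟩
  case inequivalent =>
    exact fun hequiv => eq_of_equivalent_vermaRep he' <|
      (hverma e n he).trans (hequiv.trans (hverma e' n' he').symm)
  case classification =>
    obtain ⟨v, n, e, hv⟩ := hasLowestWeightVector_iff.1 hlow
    have hequiv := (hv.equivalent_vermaRep hρ hfin).symm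
    have he := sinhQuot_ne_zero_of_isIrreducible_vermaRep (hequiv.isIrreducible hρ)
    exact ⟨e, n, he, hequiv.trans (hverma e n he)⟩
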